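/- For a positive integer $n$ let $\sigma(n)=\sum_{d\mid n} d$ be the sum of its positive divisors, and let $\gamma$ be the Euler–Mascheroni constant. Every squarefree integer $n\ge 2$ with $n\notin\{2,3,5,6,10,30\}$ satisfies Robin's inequality $$\sigma(n) < e^{\gamma}\, n\log\log n .$$ -/

import Mathlib

/-- Robin's inequality `σ(n) < e^γ n log log n`, where `σ(n)` is the sum of the divisors of `n`
and `γ` is the Euler-Mascheroni constant. (At `n = 1`, where `log log n` is undefined, the
convention `Real.log 0 = 0` makes the inequality false.) -/
def RobinInequality (n : ℕ) : Prop :=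
  (ArithmeticFunction.sigma 1 n : ℝ) <
    Real.exp Real.eulerMascheroniConstant * (n : ℝ) * Real.log (Real.log (n : ℝ))

/-- The set `𝓡` of the integers `n ≥ 1` that satisfy Robin's inequality. -/
def robinSet : Set ℕ := {n | 1 ≤ n ∧ RobinInequality n}

/-! For squarefree n, log (σ(n)/n) is the sum of log (1 + 1/p) over p ∣ n, while the log p sum to
log n. Bounding it is a fractional knapsack problem with value log (1 + 1/p) and cost log p. Since
value per cost decreases in p, the primes up to a cutoff z are the best choice, and the remaining
budget log n - θ(z) is charged at the rate c = log (1 + 1/z) / log z (`log_sigma_le_of_squarefree`).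
The bound has to stay below γ + log log log n.

For log n ≥ 900, take z = ⌊log n⌋. An explicit Mertens bound gives at most log log z + 0.4184, and
the charge is at most 0.148; the total constant 0.5664 is below 0.573 < γ. There is room because the
factors are 1 + 1/p rather than 1/(1 - 1/p). For 210 ≤ n with log n ≤ 900, the cutoffs 7, 23 and 199
suffice, concavity of log log reducing each range to endpoint checks. Smaller n are enumerated. -/

/-! ### The linear-programming bound -/

open Finset Nat in
theorem log_sigma_one_of_squarefree {n : ℕ} (hsq : Squarefree n) :
    Real.log (ArithmeticFunction.sigma 1 n) =
      Real.log n + ∑ p ∈ n.primeFactors, Real.log (1 + 1 / (p : ℝ)) := by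
  have hpos : ∀ p ∈ n.primeFactors, (0 : ℝ) < p := fun p hp =>
    Nat.cast_pos.2 (prime_of_mem_primeFactors hp).pos
  have h1 : ArithmeticFunction.sigma 1 n = ∏ p ∈ n.primeFactors, (p + 1) := by
    rw [← ArithmeticFunction.isMultiplicative_sigma.prod_primeFactors hsq]
    refine prod_congr rfl fun p hp => ?_
    rw [ArithmeticFunction.sigma_one_apply, (prime_of_mem_primeFactors hp).sum_divisors]
  have h2 : Real.log n = ∑ p ∈ n.primeFactors, Real.log p := by
    conv_lhs => rw [← prod_primeFactors_of_squarefree hsq]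
    push_cast
    exact Real.log_prod fun p hp => (hpos p hp).ne'
  rw [h1, h2, ← sum_add_distrib]
  push_cast
  rw [Real.log_prod fun p hp => by have := hpos p hp; positivity]
  refine sum_congr rfl fun p hp => ?_
  have := hpos p hp
  rw [← Real.log_mul this.ne' (by positivity)]
  congr 1
  field_simp

/-- The weight `log (1 + 1 / x) / log x` is antitone, in the cross-multiplied form. -/
theorem log_one_add_inv_le_mul_log {x y : ℝ} (hx : 1 < x) (hxy : x ≤ y) :
    Real.log (1 + 1 / y) ≤ Real.log (1 + 1 / x) / Real.log x * Real.log y := by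
  have hlx : 0 < Real.log x := Real.log_pos hx
  have h0 : 0 ≤ Real.log (1 + 1 / x) := Real.log_nonneg (by
    have : 0 ≤ 1 / x := by positivity
    linarith)
  calc Real.log (1 + 1 / y) ≤ Real.log (1 + 1 / x) := by
        have : 0 < y := by linarith
        gcongr
    _ = Real.log (1 + 1 / x) / Real.log x * Real.log x := by field_simp
    _ ≤ _ := by gcongr

theorem mul_log_le_log_one_add_inv {x y : ℝ} (hx : 1 < x) (hxy : x ≤ y) :
    Real.log (1 + 1 / y) / Real.log y * Real.log x ≤ Real.log (1 + 1 / x) := by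
  have hly : 0 < Real.log y := Real.log_pos (hx.trans_le hxy)
  have hlx : 0 < Real.log x := Real.log_pos hx
  have := log_one_add_inv_le_mul_log hx hxy
  rw [div_mul_eq_mul_div, div_le_iff₀ hly]
  rw [div_mul_eq_mul_div, le_div_iff₀ hlx] at this
  exact this

open Finset Nat in
/-- A linear-programming bound for `σ(n)/n` over squarefree `n` of given size. -/
theorem log_sigma_le_of_squarefree {n z : ℕ} (hsq : Squarefree n) (hz : 1 < z) :
    Real.log (ArithmeticFunction.sigma 1 n) ≤ Real.log n +
      ∑ p ∈ primesLE z, Real.log (1 + 1 / (p : ℝ)) +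
      Real.log (1 + 1 / (z : ℝ)) / Real.log z * (Real.log n - Chebyshev.theta z) := by
  set c := Real.log (1 + 1 / (z : ℝ)) / Real.log z with hc
  have hn2 : Real.log n = ∑ p ∈ n.primeFactors, Real.log p := by
    conv_lhs => rw [← prod_primeFactors_of_squarefree hsq]
    push_cast
    exact Real.log_prod fun p hp => Nat.cast_ne_zero.2 (prime_of_mem_primeFactors hp).ne_zero
  have hz' : (1 : ℝ) < z := by exact_mod_cast hz
  -- The summand is nonnegative for p ≤ z and nonpositive for p ≥ z, so adding missing small primes
  -- and dropping large ones can only increase the sum.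
  have key : ∑ p ∈ n.primeFactors, (Real.log (1 + 1 / (p : ℝ)) - c * Real.log p) ≤
      ∑ p ∈ primesLE z, (Real.log (1 + 1 / (p : ℝ)) - c * Real.log p) := by
    rw [← sum_filter_add_sum_filter_not n.primeFactors (· ≤ z)]
    have hA : ∑ p ∈ n.primeFactors with p ≤ z, (Real.log (1 + 1 / (p : ℝ)) - c * Real.log p) ≤
        ∑ p ∈ primesLE z, (Real.log (1 + 1 / (p : ℝ)) - c * Real.log p) := by
      refine sum_le_sum_of_subset_of_nonneg (fun p hp => ?_) fun p hp _ => ?_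
      · rw [mem_filter] at hp
        exact mem_primesLE.2 ⟨hp.2, prime_of_mem_primeFactors hp.1⟩
      · have := mul_log_le_log_one_add_inv (x := p) (y := z)
          (by exact_mod_cast (prime_of_mem_primesLE hp).one_lt)
          (by exact_mod_cast le_of_mem_primesLE hp)
        linarith
    have hB : ∑ p ∈ n.primeFactors with ¬ p ≤ z,
        (Real.log (1 + 1 / (p : ℝ)) - c * Real.log p) ≤ 0 := by
      refine sum_nonpos fun p hp => ?_
      rw [mem_filter] at hp
      have := log_one_add_inv_le_mul_log (x := z) (y := p) hz'
        (by exact_mod_cast (not_le.1 hp.2).le)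
      linarith
    linarith
  simp only [sum_sub_distrib, ← mul_sum] at key
  rw [← hn2, ← Chebyshev.theta_eq_sum_primesLE_log] at key
  rw [log_sigma_one_of_squarefree hsq]
  linarith

/-! ### Explicit upper bounds of Mertens type -/

open Finset Nat in
-- `N / p` counts the multiples of p up to N; after exchanging sums, each factor of N! is bounded
-- below by its radical.
theorem sum_div_mul_log_le_log_factorial (N : ℕ) :
    ∑ p ∈ primesLE N, ((N / p : ℕ) : ℝ) * Real.log p ≤ Real.log (N ! : ℝ) := by
  have h1 : ∀ k ∈ range N, ∑ p ∈ primesLE N, (if p ∣ k + 1 then Real.log p else 0) ≤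
      Real.log ((k + 1 : ℕ) : ℝ) := by
    intro k _
    rw [← sum_filter]
    calc ∑ p ∈ primesLE N with p ∣ k + 1, Real.log p
        ≤ ∑ p ∈ (k + 1).primeFactors, Real.log p := by
          refine sum_le_sum_of_subset_of_nonneg (fun p hp => ?_) fun p _ _ =>
            Real.log_natCast_nonneg p
          rw [mem_filter] at hp
          exact mem_primeFactors.2 ⟨prime_of_mem_primesLE hp.1, hp.2, by omega⟩
      _ = Real.log ((∏ p ∈ (k + 1).primeFactors, p : ℕ) : ℝ) := by
          push_cast
          exact (Real.log_prod fun p hp =>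
            Nat.cast_ne_zero.2 (prime_of_mem_primeFactors hp).ne_zero).symm
      _ ≤ _ := by
          have hle : ∏ p ∈ (k + 1).primeFactors, p ≤ k + 1 :=
            Nat.le_of_dvd (by omega) (prod_primeFactors_dvd _)
          have hpos : 0 < ∏ p ∈ (k + 1).primeFactors, p :=
            prod_pos fun p hp => (prime_of_mem_primeFactors hp).pos
          exact Real.log_le_log (by exact_mod_cast hpos) (by exact_mod_cast hle)
  calc ∑ p ∈ primesLE N, ((N / p : ℕ) : ℝ) * Real.log p
      = ∑ p ∈ primesLE N, ∑ k ∈ range N, (if p ∣ k + 1 then Real.log p else 0) := by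
        refine sum_congr rfl fun p _ => ?_
        rw [← sum_filter, sum_const, card_multiples, nsmul_eq_mul]
    _ = ∑ k ∈ range N, ∑ p ∈ primesLE N, (if p ∣ k + 1 then Real.log p else 0) := sum_comm
    _ ≤ ∑ k ∈ range N, Real.log ((k + 1 : ℕ) : ℝ) := sum_le_sum h1
    _ = _ := by
        rw [← prod_range_add_one_eq_factorial, Nat.cast_prod, Real.log_prod]
        intro k _
        positivity

open Nat in
theorem log_factorial_le {N : ℕ} (hN : 1 ≤ N) :
    Real.log (N ! : ℝ) ≤ N * Real.log N - N + Real.log N + 1 := by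
  induction N, hN using Nat.le_induction with
  | base => simp
  | succ N hN ih =>
    have hN' : (0 : ℝ) < N := by exact_mod_cast hN
    rw [factorial_succ, Nat.cast_mul, Real.log_mul (by positivity) (by positivity)]
    push_cast
    have h := Real.one_sub_inv_le_log_of_pos (x := ((N : ℝ) + 1) / N) (by positivity)
    rw [Real.log_div (by positivity) hN'.ne'] at h
    have h2 : 1 - (((N : ℝ) + 1) / N)⁻¹ = 1 / (N + 1) := by field_simp; ring
    rw [h2, div_le_iff₀ (by positivity)] at h
    linarith

open Finset Nat in
/-- An explicit upper bound in Mertens' first theorem. -/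
theorem sum_log_div_le {N : ℕ} (hN : 1 ≤ N) :
    ∑ p ∈ primesLE N, Real.log p / p ≤
      Real.log N + (Real.log 4 - 1) + (Real.log N + 1) / N := by
  have hN' : (0 : ℝ) < N := by exact_mod_cast hN
  have h1 : ∑ p ∈ primesLE N, (N * (Real.log p / p) - Real.log p) ≤
      ∑ p ∈ primesLE N, ((N / p : ℕ) : ℝ) * Real.log p := by
    refine sum_le_sum fun p hp => ?_
    have hp0 : (0 : ℝ) < p := by exact_mod_cast (prime_of_mem_primesLE hp).pos
    have hfl : (N : ℝ) / p - 1 ≤ ((N / p : ℕ) : ℝ) := by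
      rw [← Nat.floor_div_eq_div (K := ℝ)]
      exact (Nat.sub_one_lt_floor _).le
    calc N * (Real.log p / p) - Real.log p = ((N : ℝ) / p - 1) * Real.log p := by ring
      _ ≤ _ := by
        have := Real.log_natCast_nonneg p
        gcongr
  have h2 := sum_div_mul_log_le_log_factorial N
  have h3 := log_factorial_le hN
  -- The error from replacing ⌊N/p⌋ by N/p - 1 totals θ(N), which costs log 4 after division by N.
  have h4 := Chebyshev.theta_le_log4_mul_x hN'.le
  rw [Chebyshev.theta_eq_sum_primesLE_log] at h4
  rw [sum_sub_distrib, ← mul_sum] at h1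
  have h5 : Real.log N + (Real.log 4 - 1) + (Real.log N + 1) / N =
      (N * Real.log N - N + Real.log N + 1 + Real.log 4 * N) / N := by
    field_simp; ring
  rw [h5, le_div_iff₀ hN']
  linarith

/-- Discrete partial summation: a bound `∑ p ≤ N, log p / p ≤ log N + C` for `N ≥ m` transfers to
`∑ p ≤ N, 1 / p`. -/
theorem sum_one_div_le_of_sum_log_div_le {m N : ℕ} {C : ℝ} (hm : 2 ≤ m) (hmN : m ≤ N)
    (hC : ∀ k, m ≤ k → ∑ p ∈ Nat.primesLE k, Real.log p / p ≤ Real.log k + C) :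
    ∑ p ∈ Nat.primesLE N, 1 / (p : ℝ) ≤ ∑ p ∈ Nat.primesLE m, 1 / (p : ℝ) +
      (Real.log (Real.log N) - Real.log (Real.log m)) +
      (Real.log m + C - ∑ p ∈ Nat.primesLE m, Real.log p / p) / Real.log m := by
  set S : ℕ → ℝ := fun k => ∑ p ∈ Nat.primesLE k, 1 / (p : ℝ) with hS
  set A : ℕ → ℝ := fun k => ∑ p ∈ Nat.primesLE k, Real.log p / p with hA
  -- This quantity is nonincreasing in N, and its middle term is nonnegative by `hC`, so it may be
  -- dropped at N.
  suffices h : S N + (Real.log N + C - A N) / Real.log N - Real.log (Real.log N) ≤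
      S m + (Real.log m + C - A m) / Real.log m - Real.log (Real.log m) by
    have h1 : 0 ≤ (Real.log N + C - A N) / Real.log N :=
      div_nonneg (sub_nonneg.2 (hC N hmN)) (Real.log_natCast_nonneg N)
    linarith
  induction N, hmN using Nat.le_induction with
  | base => exact le_rfl
  | succ k hk ih =>
    refine le_trans ?_ ih
    have hk2 : (2 : ℝ) ≤ k := by exact_mod_cast hm.trans hk
    have hl : 0 < Real.log k := Real.log_pos (by linarith)
    have hl1 : Real.log k ≤ Real.log (k + 1 : ℕ) :=
      Real.log_le_log (by linarith) (by push_cast; linarith)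
    have hl2 : 0 < Real.log (k + 1 : ℕ) := hl.trans_le hl1
    have hloglog : 1 - Real.log k / Real.log (k + 1 : ℕ) ≤
        Real.log (Real.log (k + 1 : ℕ)) - Real.log (Real.log k) := by
      have := Real.one_sub_inv_le_log_of_pos (div_pos hl2 hl)
      rwa [inv_div, Real.log_div hl2.ne' hl.ne'] at this
    -- A new prime k + 1 adds the same amount, 1/(k + 1), to both terms.
    have hstep : S (k + 1) - A (k + 1) / Real.log (k + 1 : ℕ) =
        S k - A k / Real.log (k + 1 : ℕ) := by
      by_cases hp : (k + 1).Prime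
      · have e1 : S (k + 1) = S k + 1 / ((k + 1 : ℕ) : ℝ) := by
          simp only [hS, Nat.primesLE_succ, hp, if_true]
          rw [Finset.sum_insert (Nat.notMem_primesLE k), add_comm]
        have e2 : A (k + 1) = A k + Real.log (k + 1 : ℕ) / ((k + 1 : ℕ) : ℝ) := by
          simp only [hA, Nat.primesLE_succ, hp, if_true]
          rw [Finset.sum_insert (Nat.notMem_primesLE k), add_comm]
        rw [e1, e2]
        field_simp
        ring
      · simp only [hS, hA, Nat.primesLE_succ, hp, if_false]
    have hD : 0 ≤ Real.log k + C - A k := sub_nonneg.2 (hC k hk)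
    have hinv : (Real.log k + C - A k) / Real.log (k + 1 : ℕ) ≤
        (Real.log k + C - A k) / Real.log k := by gcongr
    have e3 : (Real.log (k + 1 : ℕ) + C - A (k + 1)) / Real.log (k + 1 : ℕ) =
        1 - Real.log k / Real.log (k + 1 : ℕ) - A (k + 1) / Real.log (k + 1 : ℕ) +
        A k / Real.log (k + 1 : ℕ) +
        (Real.log k + C - A k) / Real.log (k + 1 : ℕ) := by
      field_simp
      ring
    linarith

/-! ### Certified numerical bounds -/

theorem div_le_log_of_pow_le {a b : ℕ} {x : ℝ} (hb : 0 < b) (hx : 0 < x)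
    (h : (2.7182818286 : ℝ) ^ a ≤ x ^ b) : (a : ℝ) / b ≤ Real.log x := by
  have hb' : (0 : ℝ) < b := by exact_mod_cast hb
  rw [div_le_iff₀ hb', mul_comm, ← Real.log_pow, Real.le_log_iff_exp_le (by positivity)]
  refine le_trans ?_ h
  rw [← Real.exp_one_pow]
  exact pow_le_pow_left₀ (Real.exp_pos 1).le Real.exp_one_lt_d9.le a

theorem log_le_div_of_pow_le {a b : ℕ} {x : ℝ} (hb : 0 < b) (hx : 0 < x)
    (h : x ^ b ≤ (2.7182818283 : ℝ) ^ a) : Real.log x ≤ (a : ℝ) / b := by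
  have hb' : (0 : ℝ) < b := by exact_mod_cast hb
  rw [le_div_iff₀ hb', mul_comm, ← Real.log_pow, Real.log_le_iff_le_exp (by positivity)]
  refine h.trans ?_
  rw [← Real.exp_one_pow]
  exact pow_le_pow_left₀ (by norm_num) Real.exp_one_gt_d9.le a

theorem eulerMascheroniConstant_gt : (0.573 : ℝ) < Real.eulerMascheroniConstant := by
  -- The index 127 makes log (127 + 1) = 7 log 2, for which decimal bounds are known.
  refine lt_trans ?_ (Real.eulerMascheroniSeq_lt_eulerMascheroniConstant 127)
  have h : (5.4252 : ℚ) < harmonic 127 := by decide +kernel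
  have h' : ((5.4252 : ℚ) : ℝ) < (harmonic 127 : ℝ) := by exact_mod_cast h
  have h2 : Real.log ((127 : ℕ) + 1 : ℝ) = 7 * Real.log 2 := by
    rw [show ((127 : ℕ) + 1 : ℝ) = 2 ^ 7 by norm_num, Real.log_pow]; norm_num
  rw [Real.eulerMascheroniSeq, h2]
  have := Real.log_two_lt_d9
  norm_num at h' ⊢
  linarith

open Finset Nat in
theorem sum_log_one_add_inv_le {z q r : ℕ} (hq : 0 < q)
    (h : (∏ p ∈ primesLE z, (p + 1)) * q ≤ r * ∏ p ∈ primesLE z, p) :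
    ∑ p ∈ primesLE z, Real.log (1 + 1 / (p : ℝ)) ≤ Real.log (r / q : ℝ) := by
  have hp : ∀ p ∈ primesLE z, (0 : ℝ) < p := fun p hp => by
    exact_mod_cast (prime_of_mem_primesLE hp).pos
  rw [← Real.log_prod fun p h => by have := hp p h; positivity]
  have h1 : ∏ p ∈ primesLE z, (1 + 1 / (p : ℝ)) =
      (∏ p ∈ primesLE z, ((p : ℝ) + 1)) / ∏ p ∈ primesLE z, (p : ℝ) := by
    rw [← prod_div_distrib]
    refine prod_congr rfl fun p h => ?_
    have := hp p h
    field_simp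
  have h2 : 0 < ∏ p ∈ primesLE z, (p : ℝ) := prod_pos hp
  have h3 : 0 < ∏ p ∈ primesLE z, ((p : ℝ) + 1) := prod_pos fun p h => by
    have := hp p h; positivity
  rw [h1]
  refine Real.log_le_log (by positivity) ?_
  rw [div_le_div_iff₀ h2 (by exact_mod_cast hq)]
  have h' := (Nat.cast_le (α := ℝ)).2 h
  push_cast at h'
  exact h'

open Finset Nat in
-- Rounding log₂ (p ^ b) down to an integer leaves a rational sum that can be evaluated exactly;
-- larger b gives a finer approximation.
theorem log_two_mul_sum_log2_le {z b : ℕ} (hb : 0 < b) :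
    Real.log 2 / b * ∑ p ∈ primesLE z, ((p ^ b).log2 : ℝ) / p ≤
      ∑ p ∈ primesLE z, Real.log p / p := by
  rw [mul_sum]
  refine sum_le_sum fun p hp => ?_
  have hp0 : 0 < p := (prime_of_mem_primesLE hp).pos
  have hp0' : (0 : ℝ) < p := by exact_mod_cast hp0
  have hb' : (0 : ℝ) < b := by exact_mod_cast hb
  have h1 : 2 ^ (p ^ b).log2 ≤ p ^ b := Nat.log2_self_le (by positivity)
  have h2 : ((p ^ b).log2 : ℝ) * Real.log 2 ≤ b * Real.log p := by
    rw [← Real.log_pow, ← Real.log_pow]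
    exact Real.log_le_log (by positivity) (by exact_mod_cast h1)
  rw [← mul_div_assoc]
  gcongr
  rw [div_mul_eq_mul_div, div_le_iff₀ hb']
  linarith

theorem sum_log_div_primesLE_199_gt :
    (4.07 : ℝ) < ∑ p ∈ Nat.primesLE 199, Real.log p / p := by
  have h : (188 : ℚ) < ∑ p ∈ Nat.primesLE 199, ((p ^ 32).log2 : ℚ) / p := by decide +kernel
  have h' := (Rat.cast_lt (K := ℝ)).2 h
  push_cast at h'
  refine lt_of_lt_of_le ?_ (log_two_mul_sum_log2_le (b := 32) (by norm_num))
  have := Real.log_two_gt_d9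
  nlinarith

theorem sum_log_one_add_inv_primesLE_7 :
    ∑ p ∈ Nat.primesLE 7, Real.log (1 + 1 / (p : ℝ)) ≤ 1.0092 := by
  refine (sum_log_one_add_inv_le (q := 10000) (r := 27429) (by norm_num)
    (by decide +kernel)).trans ?_
  refine (log_le_div_of_pow_le (a := 111) (b := 110) (by norm_num)
    (by norm_num) ?_).trans ?_ <;> norm_num
theorem sum_log_one_add_inv_primesLE_23 :
    ∑ p ∈ Nat.primesLE 23, Real.log (1 + 1 / (p : ℝ)) ≤ 1.3215 := by
  refine (sum_log_one_add_inv_le (q := 1000) (r := 3748) (by norm_num)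
    (by decide +kernel)).trans ?_
  refine (log_le_div_of_pow_le (a := 37) (b := 28) (by norm_num)
    (by norm_num) ?_).trans ?_ <;> norm_num
theorem sum_log_one_add_inv_primesLE_199 :
    ∑ p ∈ Nat.primesLE 199, Real.log (1 + 1 / (p : ℝ)) ≤ 1.768 := by
  refine (sum_log_one_add_inv_le (q := 1000) (r := 5858) (by norm_num)
    (by decide +kernel)).trans ?_
  refine (log_le_div_of_pow_le (a := 99) (b := 56) (by norm_num)
    (by norm_num) ?_).trans ?_ <;> norm_num

/-! ### Bounded ranges of log n -/

open Real in
theorem concaveOn_log_log : ConcaveOn ℝ (Set.Ioi 1) fun t : ℝ => log (log t) := by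
  have him : log '' Set.Ioi 1 ⊆ Set.Ioi 0 := by
    rintro _ ⟨t, ht, rfl⟩
    exact log_pos ht
  have hcont : ContinuousOn log (Set.Ioi 1) := continuousOn_log.mono fun t ht => by
    have : (1 : ℝ) < t := ht
    simp only [Set.mem_compl_iff, Set.mem_singleton_iff]
    positivity
  have hconv : Convex ℝ (log '' Set.Ioi 1) :=
    ((isPreconnected_Ioi.image _ hcont).ordConnected).convex
  refine ConcaveOn.comp (g := log) (f := log) ?_ ?_ ?_
  · exact strictConcaveOn_log_Ioi.concaveOn.subset him hconv
  · exact strictConcaveOn_log_Ioi.concaveOn.subset (Set.Ioi_subset_Ioi zero_le_one)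
      (convex_Ioi 1)
  · exact strictMonoOn_log.monotoneOn.mono him

theorem robinInequality_of_log_lt {n : ℕ} (hn : 2 < n)
    (h : Real.log (ArithmeticFunction.sigma 1 n) < Real.log n +
      (Real.eulerMascheroniConstant + Real.log (Real.log (Real.log n)))) :
    RobinInequality n := by
  have hn' : (3 : ℝ) ≤ n := by exact_mod_cast hn
  have hll : 0 < Real.log (Real.log n) := Real.log_pos <| by
    rw [Real.lt_log_iff_exp_lt (by linarith)]
    linarith [Real.exp_one_lt_d9]
  have hσ : (0 : ℝ) < ArithmeticFunction.sigma 1 n := by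
    exact_mod_cast ArithmeticFunction.sigma_pos 1 n (by omega)
  rw [RobinInequality, ← Real.log_lt_log_iff hσ (by positivity),
    Real.log_mul (by positivity) hll.ne', Real.log_mul (by positivity) (by positivity),
    Real.log_exp]
  linarith

theorem log_one_add_inv_div_log_nonneg {x : ℝ} (hx : 1 < x) :
    0 ≤ Real.log (1 + 1 / x) / Real.log x := by
  have : 0 ≤ 1 / x := by positivity
  exact div_nonneg (Real.log_nonneg (by linarith)) (Real.log_pos hx).le

theorem log_one_add_inv_div_log_le {x : ℝ} (hx : 1 < x) :
    Real.log (1 + 1 / x) / Real.log x ≤ 1 / (x * Real.log x) := by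
  have hl := Real.log_pos hx
  have h0 : 0 < 1 / x := by positivity
  have h1 := Real.log_le_sub_one_of_pos (x := 1 + 1 / x) (by linarith)
  rw [← div_div]
  gcongr
  linarith

/-- Robin's inequality for squarefree `n` with `a ≤ log n ≤ b`, from finitely many numerical
conditions on the primes up to `z`. -/
theorem robinInequality_of_log_mem_Icc {n z : ℕ} {a b L t κ : ℝ} (hsq : Squarefree n)
    (hn : 2 < n) (hz : 1 < z)
    (hL : ∑ p ∈ Nat.primesLE z, Real.log (1 + 1 / (p : ℝ)) ≤ L)
    (ht : t ≤ Chebyshev.theta z) (hκ : 1 ≤ κ * (z * Real.log z)) (h1a : 1 < a) (hat : a ≤ t)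
    (htb : t ≤ b) (ha : a ≤ Real.log n) (hb : Real.log n ≤ b)
    (hLa : L < 0.573 + Real.log (Real.log a))
    (hLb : L + κ * (b - t) < 0.573 + Real.log (Real.log b)) : RobinInequality n := by
  refine robinInequality_of_log_lt hn ?_
  have hγ := eulerMascheroniConstant_gt
  have key := log_sigma_le_of_squarefree hsq hz
  have hz' : (1 : ℝ) < z := by exact_mod_cast hz
  have hc0 := log_one_add_inv_div_log_nonneg hz'
  have hcκ : Real.log (1 + 1 / (z : ℝ)) / Real.log z ≤ κ := by
    have hpos : 0 < z * Real.log z := mul_pos (by linarith) (Real.log_pos hz')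
    refine (log_one_add_inv_div_log_le hz').trans ?_
    rwa [div_le_iff₀ hpos]
  set c := Real.log (1 + 1 / (z : ℝ)) / Real.log z
  have mono : ∀ s, a ≤ s → Real.log (Real.log a) ≤ Real.log (Real.log s) := fun s hs =>
    Real.log_le_log (Real.log_pos h1a) (Real.log_le_log (by linarith) hs)
  set s := Real.log n
  -- Below t the charge is nonpositive and the condition at a suffices. Above t, log log u - κu is
  -- concave, so its minimum on [t, b] is at an endpoint; the endpoint t is covered by a ≤ t.
  rcases le_total s t with hst | hts
  · have := mono s ha
    have : c * (s - Chebyshev.theta z) ≤ 0 :=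
      mul_nonpos_of_nonneg_of_nonpos hc0 (by linarith)
    linarith
  · have h1 : c * (s - Chebyshev.theta z) ≤ κ * (s - t) :=
      (mul_le_mul_of_nonneg_left (by linarith) hc0).trans
        (mul_le_mul_of_nonneg_right hcκ (by linarith))
    have hconc : ConcaveOn ℝ (Set.Ioi (1 : ℝ)) fun u => Real.log (Real.log u) - κ * u :=
      concaveOn_log_log.sub ((convexOn_id (convex_Ioi 1)).smul (hc0.trans hcκ))
    have h2 := hconc.min_le_of_mem_Icc (x := t) (y := b) (z := s) (by simp; linarith)
      (by simp; linarith) ⟨hts, hb⟩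
    have h3 := mono t hat
    rcases min_le_iff.1 h2 with h | h <;> linarith

theorem robinInequality_of_log_mem_Icc_five_eleven {n : ℕ} (hsq : Squarefree n) (hn : 2 < n)
    (ha : 16 / 3 ≤ Real.log n) (hb : Real.log n ≤ 11) : RobinInequality n := by
  have e1 : (1.94 : ℝ) ≤ Real.log 7 := by
    refine le_trans ?_ (div_le_log_of_pow_le (a := 97) (b := 50) ?_ ?_ ?_) <;> norm_num
  have e2 : (0.5 : ℝ) ≤ Real.log (5 / 3) := by
    refine le_trans ?_ (div_le_log_of_pow_le (a := 1) (b := 2) ?_ ?_ ?_) <;> norm_num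
  have e3 : (5 / 3 : ℝ) ≤ Real.log (16 / 3) := by
    refine le_trans ?_ (div_le_log_of_pow_le (a := 5) (b := 3) ?_ ?_ ?_) <;> norm_num
  have e4 : (19 / 8 : ℝ) ≤ Real.log 11 := by
    refine le_trans ?_ (div_le_log_of_pow_le (a := 19) (b := 8) ?_ ?_ ?_) <;> norm_num
  have e5 : (6 / 7 : ℝ) ≤ Real.log (19 / 8) := by
    refine le_trans ?_ (div_le_log_of_pow_le (a := 6) (b := 7) ?_ ?_ ?_) <;> norm_num
  have e6 := Real.log_le_log (by norm_num) e3
  have e7 := Real.log_le_log (by norm_num) e4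
  have hθ : (16 / 3 : ℝ) ≤ Chebyshev.theta (7 : ℕ) := by
    rw [Chebyshev.theta_eq_log_primorial, Nat.floor_natCast,
      show primorial 7 = 210 by decide +kernel]
    refine le_trans ?_ (div_le_log_of_pow_le (a := 16) (b := 3) ?_ ?_ ?_) <;> norm_num
  -- κ slightly exceeds 1 / (7 · 1.94), an upper bound for 1 / (7 log 7).
  refine robinInequality_of_log_mem_Icc (κ := 0.0737) hsq hn (by norm_num)
    sum_log_one_add_inv_primesLE_7 hθ ?_ ?_ le_rfl ?_ ha hb ?_ ?_ <;> push_cast <;> linarith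

theorem robinInequality_of_log_mem_Icc_eleven_sixty {n : ℕ} (hsq : Squarefree n) (hn : 2 < n)
    (ha : 11 ≤ Real.log n) (hb : Real.log n ≤ 60) : RobinInequality n := by
  have e1 : (3.1 : ℝ) ≤ Real.log 23 := by
    refine le_trans ?_ (div_le_log_of_pow_le (a := 31) (b := 10) ?_ ?_ ?_) <;> norm_num
  have e2 : (19 / 8 : ℝ) ≤ Real.log 11 := by
    refine le_trans ?_ (div_le_log_of_pow_le (a := 19) (b := 8) ?_ ?_ ?_) <;> norm_num
  have e3 : (6 / 7 : ℝ) ≤ Real.log (19 / 8) := by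
    refine le_trans ?_ (div_le_log_of_pow_le (a := 6) (b := 7) ?_ ?_ ?_) <;> norm_num
  have e4 : (4 : ℝ) ≤ Real.log 60 := by
    refine le_trans ?_ (div_le_log_of_pow_le (a := 4) (b := 1) ?_ ?_ ?_) <;> norm_num
  have e5 : (11 / 8 : ℝ) ≤ Real.log 4 := by
    refine le_trans ?_ (div_le_log_of_pow_le (a := 11) (b := 8) ?_ ?_ ?_) <;> norm_num
  have e6 := Real.log_le_log (by norm_num) e2
  have e7 := Real.log_le_log (by norm_num) e4
  have hθ : (19 : ℝ) ≤ Chebyshev.theta (23 : ℕ) := by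
    rw [Chebyshev.theta_eq_log_primorial, Nat.floor_natCast,
      show primorial 23 = 223092870 by decide +kernel]
    refine le_trans ?_ (div_le_log_of_pow_le (a := 19) (b := 1) ?_ ?_ ?_) <;> norm_num
  refine robinInequality_of_log_mem_Icc (κ := 0.0141) hsq hn (by norm_num)
    sum_log_one_add_inv_primesLE_23 hθ ?_ ?_ ?_ ?_ ha hb ?_ ?_ <;> push_cast <;> linarith

theorem log_log_900_ge : (1.9 : ℝ) ≤ Real.log (Real.log 900) ∧ (6.8 : ℝ) ≤ Real.log 900 := by
  have e4 : (6.8 : ℝ) ≤ Real.log 900 := by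
    refine le_trans ?_ (div_le_log_of_pow_le (a := 34) (b := 5) ?_ ?_ ?_) <;> norm_num
  have e5 : (1.9 : ℝ) ≤ Real.log 6.8 := by
    refine le_trans ?_ (div_le_log_of_pow_le (a := 19) (b := 10) ?_ ?_ ?_) <;> norm_num
  exact ⟨e5.trans (Real.log_le_log (by norm_num) e4), e4⟩

theorem log_199_bounds : (37 / 7 : ℝ) ≤ Real.log 199 ∧ Real.log 199 ≤ 5.295 ∧
    (1.66 : ℝ) ≤ Real.log (Real.log 199) := by
  have e1 : (37 / 7 : ℝ) ≤ Real.log 199 := by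
    refine le_trans ?_ (div_le_log_of_pow_le (a := 37) (b := 7) ?_ ?_ ?_) <;> norm_num
  have e2 : Real.log 199 ≤ 5.295 := by
    refine (log_le_div_of_pow_le (a := 90) (b := 17) ?_ ?_ ?_).trans ?_ <;> norm_num
  have e3 : (1.66 : ℝ) ≤ Real.log (37 / 7) := by
    refine le_trans ?_ (div_le_log_of_pow_le (a := 83) (b := 50) ?_ ?_ ?_) <;> norm_num
  exact ⟨e1, e2, e3.trans (Real.log_le_log (by norm_num) e1)⟩

theorem robinInequality_of_log_mem_Icc_sixty_nine_hundred {n : ℕ} (hsq : Squarefree n)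
    (hn : 2 < n) (ha : 60 ≤ Real.log n) (hb : Real.log n ≤ 900) : RobinInequality n := by
  obtain ⟨e1, -, -⟩ := log_199_bounds
  obtain ⟨e2, -⟩ := log_log_900_ge
  have e4 : (4 : ℝ) ≤ Real.log 60 := by
    refine le_trans ?_ (div_le_log_of_pow_le (a := 4) (b := 1) ?_ ?_ ?_) <;> norm_num
  have e5 : (11 / 8 : ℝ) ≤ Real.log 4 := by
    refine le_trans ?_ (div_le_log_of_pow_le (a := 11) (b := 8) ?_ ?_ ?_) <;> norm_num
  have e6 := Real.log_le_log (by norm_num) e4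
  have hθ : (180 : ℝ) ≤ Chebyshev.theta (199 : ℕ) := by
    rw [Chebyshev.theta_eq_log_primorial, Nat.floor_natCast]
    have h : 10 ^ 81 ≤ primorial 199 := by decide +kernel
    refine le_trans ?_ (Real.log_le_log (by norm_num) ((Nat.cast_le (α := ℝ)).2 h))
    refine le_trans ?_ (div_le_log_of_pow_le (a := 180) (b := 1) ?_ ?_ ?_) <;> norm_num
  refine robinInequality_of_log_mem_Icc (κ := 0.000958) hsq hn (by norm_num)
    sum_log_one_add_inv_primesLE_199 hθ ?_ ?_ ?_ ?_ ha hb ?_ ?_ <;> push_cast <;> linarith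

/-! ### Large n -/

theorem sum_log_div_le_of_199_le {k : ℕ} (hk : 199 ≤ k) :
    ∑ p ∈ Nat.primesLE k, Real.log p / p ≤ Real.log k + 0.418 := by
  have hk' : (199 : ℝ) ≤ k := by exact_mod_cast hk
  have h1 := sum_log_div_le (N := k) (by omega)
  -- log x / x decreases beyond e, so the error is largest at 199, and log 4 - 1 + 6.295/199 <
  -- 0.418.
  have h2 : Real.log k / k ≤ Real.log 199 / 199 :=
    Real.log_div_self_antitoneOn (by simp; linarith [Real.exp_one_lt_d9])
      (by simp; linarith [Real.exp_one_lt_d9]) hk'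
  have h3 : 1 / (k : ℝ) ≤ 1 / 199 := by gcongr
  have h4 : Real.log 4 = 2 * Real.log 2 := by
    rw [show (4 : ℝ) = 2 ^ 2 by norm_num, Real.log_pow]; norm_num
  have h5 := Real.log_two_lt_d9
  have h6 := log_199_bounds.2.1
  rw [add_div] at h1
  linarith

/-- An explicit upper bound in Mertens' third theorem, for the product of `1 + 1 / p`. -/
theorem sum_log_one_add_inv_le_of_199_le {N : ℕ} (hN : 199 ≤ N) :
    ∑ p ∈ Nat.primesLE N, Real.log (1 + 1 / (p : ℝ)) ≤ Real.log (Real.log N) + 0.4184 := by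
  have h1 := sum_one_div_le_of_sum_log_div_le (by norm_num) hN
    fun k hk => sum_log_div_le_of_199_le hk
  have hsub := Nat.primesLE_mono hN
  -- Only primes beyond 199 are relaxed to 1/p. The final constant is 1.768 - 1.66 + 0.3104 =
  -- 0.4184.
  have h2 : ∑ p ∈ Nat.primesLE N \ Nat.primesLE 199, Real.log (1 + 1 / (p : ℝ)) ≤
      ∑ p ∈ Nat.primesLE N \ Nat.primesLE 199, 1 / (p : ℝ) := by
    refine Finset.sum_le_sum fun p _ => ?_
    have h0 : (0 : ℝ) ≤ 1 / p := by positivity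
    have := Real.log_le_sub_one_of_pos (x := 1 + 1 / (p : ℝ)) (by linarith)
    linarith
  have h3 := Finset.sum_sdiff (f := fun p : ℕ => Real.log (1 + 1 / (p : ℝ))) hsub
  have h4 := Finset.sum_sdiff (f := fun p : ℕ => 1 / (p : ℝ)) hsub
  have h5 := sum_log_one_add_inv_primesLE_199
  have h6 := sum_log_div_primesLE_199_gt
  obtain ⟨e1, e2, e3⟩ := log_199_bounds
  push_cast at h1
  have h7 : (Real.log 199 + 0.418 - ∑ p ∈ Nat.primesLE 199, Real.log p / p) / Real.log 199 ≤
      0.3104 := by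
    rw [div_le_iff₀ (by linarith)]
    linarith
  linarith

theorem robinInequality_of_900_le_log {n : ℕ} (hsq : Squarefree n) (hn : 2 < n)
    (h : 900 ≤ Real.log n) : RobinInequality n := by
  refine robinInequality_of_log_lt hn ?_
  set y := Real.log n
  set N := ⌊y⌋₊
  have hN : 900 ≤ N := Nat.le_floor (by exact_mod_cast h)
  have hN' : (900 : ℝ) ≤ N := by exact_mod_cast hN
  have hNy : (N : ℝ) ≤ y := Nat.floor_le (by linarith)
  have hyN : y < N + 1 := Nat.lt_floor_add_one y
  have key := log_sigma_le_of_squarefree hsq (z := N) (by omega)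
  have hP := sum_log_one_add_inv_le_of_199_le (N := N) (by omega)
  have hlog : (6.8 : ℝ) ≤ Real.log N :=
    log_log_900_ge.2.trans (Real.log_le_log (by norm_num) hN')
  have hmono : Real.log (Real.log N) ≤ Real.log (Real.log y) :=
    Real.log_le_log (by linarith) (Real.log_le_log (by linarith) hNy)
  have hc0 := log_one_add_inv_div_log_nonneg (x := N) (by linarith)
  have hc := log_one_add_inv_div_log_le (x := N) (by linarith)
  set c := Real.log (1 + 1 / (N : ℝ)) / Real.log N
  -- Discarding θ(N) costs only about 1 / log N, so no lower bound on θ is needed; 901 / (900 · 6.8)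
  -- < 0.148.
  have hcy : c * (y - Chebyshev.theta N) ≤ 0.148 := by
    calc c * (y - Chebyshev.theta N) ≤ c * y := by
          have := Chebyshev.theta_nonneg N
          gcongr
          linarith
      _ ≤ 1 / (N * Real.log N) * y := by gcongr
      _ ≤ 0.148 := by
          rw [div_mul_eq_mul_div, div_le_iff₀ (by positivity)]
          nlinarith
  have hγ := eulerMascheroniConstant_gt
  linarith

/-! ### Small n and conclusion -/

theorem exp_eulerMascheroniConstant_gt : (1.773 : ℝ) < Real.exp Real.eulerMascheroniConstant := by
  refine lt_of_le_of_lt ?_ (Real.exp_lt_exp.2 eulerMascheroniConstant_gt)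
  rw [← Real.log_le_iff_le_exp (by norm_num)]
  refine (log_le_div_of_pow_le (a := 63) (b := 110) ?_ ?_ ?_).trans ?_ <;> norm_num

theorem robinInequality_of_le {n a : ℕ} {v q : ℝ} (ha : 3 ≤ a) (han : a ≤ n) (hv : 0 < v)
    (hva : v ≤ Real.log (Real.log a)) (hq : q ≤ 1.773 * v)
    (hσ : (ArithmeticFunction.sigma 1 n : ℝ) ≤ q * n) : RobinInequality n := by
  have ha' : (3 : ℝ) ≤ a := by exact_mod_cast ha
  have hn' : (a : ℝ) ≤ n := by exact_mod_cast han
  have h1 : v ≤ Real.log (Real.log n) := hva.trans <|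
    Real.log_le_log (Real.log_pos (by linarith)) (Real.log_le_log (by linarith) hn')
  have hn0 : (0 : ℝ) < n := by linarith
  calc (ArithmeticFunction.sigma 1 n : ℝ) ≤ q * n := hσ
    _ ≤ 1.773 * v * n := by gcongr
    _ < Real.exp Real.eulerMascheroniConstant * v * n := by
      gcongr
      exact exp_eulerMascheroniConstant_gt
    _ ≤ Real.exp Real.eulerMascheroniConstant * Real.log (Real.log n) * n := by gcongr
    _ = _ := by ring

theorem robinInequality_of_lt_210 {n : ℕ} (hn : 1 < n) (hn' : n < 210) (hsq : Squarefree n)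
    (hB : n ∉ ({2, 3, 5, 6, 10, 30} : Set ℕ)) : RobinInequality n := by
  simp only [Set.mem_insert_iff, Set.mem_singleton_iff, not_or] at hB
  -- In each block the bound on σ(m)/m is attained at the left end 7, 14 or 42, where log log m is
  -- also smallest.
  have hdec : ∀ m ∈ Finset.Ico 7 210, Squarefree m → m ≠ 10 → m ≠ 30 →
      (m < 14 → 7 * ArithmeticFunction.sigma 1 m ≤ 8 * m) ∧
      (14 ≤ m → m < 42 → 7 * ArithmeticFunction.sigma 1 m ≤ 12 * m) ∧
      (42 ≤ m → 7 * ArithmeticFunction.sigma 1 m ≤ 16 * m) := by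
    decide +kernel
  have h7 : 7 ≤ n := by
    by_contra h
    have h4 : n ≠ 4 := by
      rintro rfl
      exact absurd hsq (by decide +kernel)
    omega
  obtain ⟨hA, hB', hC⟩ := hdec n (Finset.mem_Ico.2 ⟨h7, hn'⟩) hsq (by omega) (by omega)
  rcases lt_or_ge n 14 with h | h
  · have e1 : (1.94 : ℝ) ≤ Real.log 7 := by
      refine le_trans ?_ (div_le_log_of_pow_le (a := 97) (b := 50) ?_ ?_ ?_) <;> norm_num
    have e2 : (0.66 : ℝ) ≤ Real.log 1.94 := by
      refine le_trans ?_ (div_le_log_of_pow_le (a := 33) (b := 50) ?_ ?_ ?_) <;> norm_num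
    refine robinInequality_of_le (a := 7) (q := 8 / 7) (by norm_num) h7 (by norm_num)
      (e2.trans (Real.log_le_log (by norm_num) e1)) (by norm_num) ?_
    have := (Nat.cast_le (α := ℝ)).2 (hA h)
    push_cast at this
    linarith
  rcases lt_or_ge n 42 with h' | h'
  · have e1 : (29 / 11 : ℝ) ≤ Real.log 14 := by
      refine le_trans ?_ (div_le_log_of_pow_le (a := 29) (b := 11) ?_ ?_ ?_) <;> norm_num
    have e2 : (0.968 : ℝ) ≤ Real.log (29 / 11) := by
      refine le_trans ?_ (div_le_log_of_pow_le (a := 121) (b := 125) ?_ ?_ ?_) <;> norm_num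
    refine robinInequality_of_le (a := 14) (q := 12 / 7) (by norm_num) h (by norm_num)
      (e2.trans (Real.log_le_log (by norm_num) e1)) (by norm_num) ?_
    have := (Nat.cast_le (α := ℝ)).2 (hB' h h')
    push_cast at this
    linarith
  · have e1 : (3.72 : ℝ) ≤ Real.log 42 := by
      refine le_trans ?_ (div_le_log_of_pow_le (a := 93) (b := 25) ?_ ?_ ?_) <;> norm_num
    have e2 : (1.3 : ℝ) ≤ Real.log 3.72 := by
      refine le_trans ?_ (div_le_log_of_pow_le (a := 13) (b := 10) ?_ ?_ ?_) <;> norm_num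
    refine robinInequality_of_le (a := 42) (q := 16 / 7) (by norm_num) h' (by norm_num)
      (e2.trans (Real.log_le_log (by norm_num) e1)) (by norm_num) ?_
    have := (Nat.cast_le (α := ℝ)).2 (hC h')
    push_cast at this
    linarith

theorem theorem1 (n : ℕ) (hn : 1 < n) (hsq : Squarefree n)
    (hB : n ∉ ({2, 3, 5, 6, 10, 30} : Set ℕ)) : n ∈ robinSet := by
  refine ⟨hn.le, ?_⟩
  rcases lt_or_ge n 210 with h | h
  · exact robinInequality_of_lt_210 hn h hsq hB
  have hn2 : 2 < n := by omega
  have hlog : (16 / 3 : ℝ) ≤ Real.log n := by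
    refine le_trans ?_ (Real.log_le_log (x := 210) (by norm_num) (by exact_mod_cast h))
    refine le_trans ?_ (div_le_log_of_pow_le (a := 16) (b := 3) ?_ ?_ ?_) <;> norm_num
  rcases le_total (Real.log n) 11 with h1 | h1
  · exact robinInequality_of_log_mem_Icc_five_eleven hsq hn2 hlog h1
  rcases le_total (Real.log n) 60 with h2 | h2
  · exact robinInequality_of_log_mem_Icc_eleven_sixty hsq hn2 h1 h2
  rcases le_total (Real.log n) 900 with h3 | h3
  · exact robinInequality_of_log_mem_Icc_sixty_nine_hundred hsq hn2 h2 h3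
  · exact robinInequality_of_900_le_log hsq hn2 h3
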